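/- For a positive integer $k$ let $G_k$ be the graph obtained from the complete graph $K_k$ on the vertices $v_0,\dots,v_{k-1}$ by subdividing every edge once, that is, by replacing each edge $v_iv_j$ with a path of two edges through a new vertex $w_{ij}$. The geometric thickness $\bar\theta(G)$ of a graph $G$ is the minimum number of layers in a straight-line drawing of $G$ in the plane (vertices are placed at distinct points, each edge is drawn as the straight segment between its endpoints and contains no other vertex) in which each edge is assigned to a single layer and no two edges of the same layer cross, i.e. two distinct edges of the same layer meet at most in a common endpoint. For every $k\ge 5$, $\bar\theta(G_k)=2$. Moreover, a two-layer straight-line drawing of $G_k$ is obtained by placing $v_i$ at $(i,i+1)$ for $0\le i<k$ and, for $0\le i<j<k$, placing $w_{ij}$ at $(j+1,i)$, with the edge $v_iw_{ij}$ on the first layer and the edge $w_{ij}v_j$ on the second. -/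

import Mathlib

/-- The graph obtained from `G` by subdividing every edge exactly once: its vertices are the
vertices `Sum.inl v` of `G` together with one new vertex `Sum.inr e` for every edge `e` of `G`,
and `Sum.inr e` is joined precisely to the two endpoints of `e`. -/
def SimpleGraph.subdivideOnce {V : Type*} (G : SimpleGraph V) : SimpleGraph (V ⊕ G.edgeSet) where
  Adj
    | Sum.inl v, Sum.inr e => v ∈ (e : Sym2 V)
    | Sum.inr e, Sum.inl v => v ∈ (e : Sym2 V)
    | _, _ => False
  symm := ⟨by rintro (v | e) (w | f) h <;> exact h⟩
  loopless := ⟨by rintro (v | e) h <;> exact h⟩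

/-- The complete graph on `k` vertices with every edge subdivided once. -/
abbrev subdividedComplete (k : ℕ) :
    SimpleGraph (Fin k ⊕ (⊤ : SimpleGraph (Fin k)).edgeSet) :=
  (⊤ : SimpleGraph (Fin k)).subdivideOnce

/-- `pos` and `layer` describe a straight-line drawing of `G` in the plane with `n` layers:
the vertices are placed at distinct points, the edge `uv` is drawn as the segment from `pos u` to
`pos v` and contains no vertex other than its endpoints, each edge belongs to one of the layers
`0, …, n - 1` (the values of `layer` off the edge set are irrelevant), and two distinct edges
of the same layer do not cross: they meet at most in the point of a common endpoint. -/
structure IsLayeredDrawing {V : Type*} (G : SimpleGraph V) (n : ℕ)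
    (pos : V → ℝ × ℝ) (layer : Sym2 V → ℕ) : Prop where
  injective : Function.Injective pos
  vertex_notMem : ∀ u v w, G.Adj u v → w ≠ u → w ≠ v → pos w ∉ segment ℝ (pos u) (pos v)
  layer_lt : ∀ e ∈ G.edgeSet, layer e < n
  noncrossing : ∀ u v w x, G.Adj u v → G.Adj w x → s(u, v) ≠ s(w, x) →
    layer s(u, v) = layer s(w, x) →
    segment ℝ (pos u) (pos v) ∩ segment ℝ (pos w) (pos x) ⊆ pos '' ({u, v} ∩ {w, x})

/-- The geometric thickness of `G`: the least `n` such that `G` has a straight-line drawing with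
`n` layers (and `⊤` if there is no such `n`, which does not happen for finite graphs). -/
noncomputable def geometricThickness {V : Type*} (G : SimpleGraph V) : ℕ∞ :=
  ⨅ (n : ℕ) (_ : ∃ pos layer, IsLayeredDrawing G n pos layer), (n : ℕ∞)

/-! The lower bound is a parity argument in the style of Hanani–Tutte. A one-layer drawing would be
a plane drawing of a subdivided $K_5$, with each edge $v_iv_j$ drawn as a path bent at $w_{ij}$. A
small perturbation puts the points in general position and keeps disjoint segments disjoint, so only
orientation signs modulo 2 matter. Replace each bent path by the straight segment $v_iv_j$: its
crossings with the independent edges change only through the vertices inside the triangle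
$v_iw_{ij}v_j$ (`IsOrientation.crossBit_triangle`). Each outside vertex $v_m$ lies on exactly two
edges independent of $v_iv_j$, so the total number of crossings between independent edges keeps its
parity. Independent bent paths do not cross, so the straight $K_5$ would have an even number of
crossings, whereas five points always span an odd number (`IsOrientation.sum_crossBit_five`).

For the upper bound, each edge of the staircase drawing stays in a strip of width one: horizontal on
the first layer, vertical on the second. Edges in the same strip start at a common $v$ and fan out;
edges in different strips could meet only on a shared boundary line, where their endpoints differ.
-/

/-! ### Orientations and crossing parity -/

/-- Twice the signed area of the triangle `a b c`. -/
def signedArea (a b c : ℝ × ℝ) : ℝ :=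
  (b.1 - a.1) * (c.2 - a.2) - (b.2 - a.2) * (c.1 - a.1)

/-- The sign of a real number as a bit: `1` for positive and `0` otherwise. -/
noncomputable def signBit (r : ℝ) : ZMod 2 := if 0 < r then 1 else 0

/-- The orientation of the triangle `a b c` as a bit. -/
noncomputable def orientBit (a b c : ℝ × ℝ) : ZMod 2 := signBit (signedArea a b c)

/-- In terms of an orientation function `x`: whether the segments `a b` and `c d` cross. -/
def crossBit {V : Type*} (x : V → V → V → ZMod 2) (a b c d : V) : ZMod 2 :=
  (x a b c + x a b d) * (x c d a + x c d b)

/-- In terms of an orientation function `x`: whether `d` lies in the triangle `a b c`. -/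
def insideBit {V : Type*} (x : V → V → V → ZMod 2) (a b c d : V) : ZMod 2 :=
  (1 + x a b d + x b c d) * (1 + x b c d + x c a d)

theorem signBit_neg {r : ℝ} (hr : r ≠ 0) : signBit (-r) = signBit r + 1 := by
  unfold signBit
  rcases lt_or_gt_of_ne hr with h | h
  · simp [h, not_lt.2 h.le]
  · simp [h, not_lt.2 h.le]
    decide

theorem signBit_add {x y : ℝ} (hx : x ≠ 0) (hy : y ≠ 0) :
    (0 < x * y ∧ signBit x + signBit y = 0) ∨ (x * y < 0 ∧ signBit x + signBit y = 1) := by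
  rcases lt_or_gt_of_ne hx with hx | hx <;> rcases lt_or_gt_of_ne hy with hy | hy
  · exact Or.inl ⟨mul_pos_of_neg_of_neg hx hy, by simp [signBit, hx.not_gt, hy.not_gt]⟩
  · exact Or.inr ⟨mul_neg_of_neg_of_pos hx hy, by simp [signBit, hx.not_gt, hy]⟩
  · exact Or.inr ⟨mul_neg_of_pos_of_neg hx hy, by simp [signBit, hx, hy.not_gt]⟩
  · exact Or.inl ⟨mul_pos hx hy, by simp only [signBit, hx, hy, if_true]; decide⟩

/-- Three nonzero products that sum to zero do not all have the same sign. -/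
theorem signBit_mul_add_mul_add_mul {r r' s s' t t' : ℝ} (h : r * r' + s * s' + t * t' = 0)
    (hr : r ≠ 0) (hr' : r' ≠ 0) (hs : s ≠ 0) (hs' : s' ≠ 0) (ht : t ≠ 0) (ht' : t' ≠ 0) :
    (1 + (signBit r + signBit r') + (signBit s + signBit s')) *
      (1 + (signBit s + signBit s') + (signBit t + signBit t')) = 0 := by
  rcases signBit_add hr hr' with ⟨h1, e1⟩ | ⟨h1, e1⟩ <;> rcases signBit_add hs hs' with ⟨h2, e2⟩ | ⟨h2, e2⟩ <;>
    rcases signBit_add ht ht' with ⟨h3, e3⟩ | ⟨h3, e3⟩ <;> rw [e1, e2, e3] <;>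
    first | decide | (exfalso; linarith)

/-- Bits `x a b c` that behave like the orientations of triples of a point set in general
position: they are alternating and satisfy the sign version of the three-term Plücker relations. -/
structure IsOrientation {V : Type*} (x : V → V → V → ZMod 2) : Prop where
  swap : ∀ a b c, a ≠ b → a ≠ c → b ≠ c → x b a c = x a b c + 1
  rotate : ∀ a b c, x b c a = x a b c
  pluecker : ∀ a b c d e, a ≠ b → a ≠ c → b ≠ c → d ≠ e →
    a ≠ d → b ≠ d → c ≠ d → a ≠ e → b ≠ e → c ≠ e →
    (1 + (x a b d + x d e c) + (x b c d + x d e a)) *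
      (1 + (x b c d + x d e a) + (x c a d + x d e b)) = 0

/-- The last property comes from the Grassmann–Plücker identity $[abd][dec]+[bcd][dea]+[cad][deb]=0$
for signed areas, whose factors are nonzero in general position. -/
theorem isOrientation_orientBit {V : Type*} {p : V → ℝ × ℝ}
    (hp : ∀ a b c, a ≠ b → a ≠ c → b ≠ c → signedArea (p a) (p b) (p c) ≠ 0) :
    IsOrientation fun a b c => orientBit (p a) (p b) (p c) where
  swap a b c hab hac hbc := by
    rw [orientBit, orientBit, ← signBit_neg (hp a b c hab hac hbc)]
    congr 1
    unfold signedArea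
    ring
  rotate a b c := by
    unfold orientBit
    congr 1
    unfold signedArea
    ring
  pluecker a b c d e hab hac hbc hde had hbd hcd hae hbe hce := by
    refine signBit_mul_add_mul_add_mul ?_ (hp _ _ _ hab had hbd) (hp _ _ _ hde hcd.symm hce.symm)
      (hp _ _ _ hbc hbd hcd) (hp _ _ _ hde had.symm hae.symm)
      (hp _ _ _ hac.symm hcd had) (hp _ _ _ hde hbd.symm hbe.symm)
    unfold signedArea
    ring

/-- A segment crosses the boundary of a triangle evenly often, unless it has exactly one of its
endpoints inside. -/
theorem IsOrientation.crossBit_triangle {V : Type*} {x : V → V → V → ZMod 2}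
    (hx : IsOrientation x) {a b c d e : V} (hab : a ≠ b) (hac : a ≠ c) (hbc : b ≠ c)
    (hde : d ≠ e) (had : a ≠ d) (hbd : b ≠ d) (hcd : c ≠ d) (hae : a ≠ e) (hbe : b ≠ e)
    (hce : c ≠ e) :
    crossBit x a b d e + crossBit x b c d e + crossBit x c a d e =
      insideBit x a b c d + insideBit x a b c e := by
  have h₁ := hx.pluecker a b c d e hab hac hbc hde had hbd hcd hae hbe hce
  -- Exchanging `d` and `e` gives a second relation, in which every bit of the form `x d e z` is
  -- flipped. The two relations exclude exactly enough sign patterns for the parity claim to become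
  -- a finite check.
  have h₂ := hx.pluecker a b c e d hab hac hbc hde.symm hae hbe hce had hbd hcd
  have hs : ∀ z, d ≠ z → e ≠ z → x e d z = x d e z + 1 := fun z => hx.swap d e z hde
  rw [hs a had.symm hae.symm, hs b hbd.symm hbe.symm, hs c hcd.symm hce.symm] at h₂
  have key : ∀ p q r p' q' r' A B C : ZMod 2,
      (1 + (p + C) + (q + A)) * (1 + (q + A) + (r + B)) = 0 →
      (1 + (p' + (C + 1)) + (q' + (A + 1))) * (1 + (q' + (A + 1)) + (r' + (B + 1))) = 0 →
      (p + p') * (A + B) + (q + q') * (B + C) + (r + r') * (C + A) =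
        (1 + p + q) * (1 + q + r) + (1 + p' + q') * (1 + q' + r') := by
    decide
  exact key _ _ _ _ _ _ _ _ _ h₁ h₂

theorem crossBit_comm {V : Type*} (x : V → V → V → ZMod 2) (a b c d : V) :
    crossBit x a b c d = crossBit x c d a b :=
  mul_comm _ _

/-- Whether some two opposite sides or diagonals of four points cross is determined by the sum of
their orientations. -/
theorem IsOrientation.sum_crossBit_four {V : Type*} {x : V → V → V → ZMod 2}
    (hx : IsOrientation x) {a b c d : V} (hab : a ≠ b) (hac : a ≠ c) (had : a ≠ d)
    (hbc : b ≠ c) (hbd : b ≠ d) (hcd : c ≠ d) :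
    crossBit x a b c d + crossBit x a c b d + crossBit x a d b c =
      x a b c + x a b d + x a c d + x b c d + 1 := by
  unfold crossBit
  rw [hx.rotate a c d, hx.rotate b c d, hx.rotate a b d, hx.rotate a b c, hx.rotate b a c,
    hx.rotate c b d, hx.rotate b a d, hx.rotate c a d, hx.swap a b c hab hac hbc,
    hx.swap b c d hbc hbd hcd, hx.swap a b d hab had hbd, hx.swap a c d hac had hcd]
  generalize x a b c = p, x a b d = q, x a c d = r, x b c d = s
  revert p q r s
  decide

/-- Five points in general position span an odd number of crossings. -/
theorem IsOrientation.sum_crossBit_five {V : Type*} {x : V → V → V → ZMod 2}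
    (hx : IsOrientation x) {v : Fin 5 → V} (hv : Function.Injective v) :
    (crossBit x (v 0) (v 1) (v 2) (v 3) + crossBit x (v 0) (v 2) (v 1) (v 3) +
      crossBit x (v 0) (v 3) (v 1) (v 2)) +
    (crossBit x (v 0) (v 1) (v 2) (v 4) + crossBit x (v 0) (v 2) (v 1) (v 4) +
      crossBit x (v 0) (v 4) (v 1) (v 2)) +
    (crossBit x (v 0) (v 1) (v 3) (v 4) + crossBit x (v 0) (v 3) (v 1) (v 4) +
      crossBit x (v 0) (v 4) (v 1) (v 3)) +
    (crossBit x (v 0) (v 2) (v 3) (v 4) + crossBit x (v 0) (v 3) (v 2) (v 4) +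
      crossBit x (v 0) (v 4) (v 2) (v 3)) +
    (crossBit x (v 1) (v 2) (v 3) (v 4) + crossBit x (v 1) (v 3) (v 2) (v 4) +
      crossBit x (v 1) (v 4) (v 2) (v 3)) = 1 := by
  have four : ∀ a b c d : Fin 5, a < b → b < c → c < d → _ := fun a b c d hab hbc hcd =>
    hx.sum_crossBit_four (hv.ne hab.ne) (hv.ne (hab.trans hbc).ne)
      (hv.ne ((hab.trans hbc).trans hcd).ne) (hv.ne hbc.ne) (hv.ne (hbc.trans hcd).ne)
      (hv.ne hcd.ne)
  rw [four 0 1 2 3 (by decide) (by decide) (by decide),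
    four 0 1 2 4 (by decide) (by decide) (by decide),
    four 0 1 3 4 (by decide) (by decide) (by decide),
    four 0 2 3 4 (by decide) (by decide) (by decide),
    four 1 2 3 4 (by decide) (by decide) (by decide)]
  -- Each of the ten triples lies in two of the five quadruples, so the orientations cancel and the
  -- five constants `1` remain.
  have two : (2 : ZMod 2) = 0 := rfl
  linear_combination (x (v 0) (v 1) (v 2) + x (v 0) (v 1) (v 3) + x (v 0) (v 1) (v 4) +
    x (v 0) (v 2) (v 3) + x (v 0) (v 2) (v 4) + x (v 0) (v 3) (v 4) + x (v 1) (v 2) (v 3) +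
    x (v 1) (v 2) (v 4) + x (v 1) (v 3) (v 4) + x (v 2) (v 3) (v 4) + 2) * two

/-- If the edges `i j` of the complete graph on `v` are drawn as paths of two segments with bend
`w i j` and in general position, then some two independent edges cross. -/
theorem IsOrientation.exists_crossBit_ne_zero {V : Type*} {x : V → V → V → ZMod 2}
    (hx : IsOrientation x) {v : Fin 5 → V} (hv : Function.Injective v) {w : Fin 5 → Fin 5 → V}
    (hvw : ∀ i j m, i < j → v m ≠ w i j)
    (hw : ∀ i j k l, i < j → k < l → i ≠ k → w i j ≠ w k l) :
    ∃ i j k l, i < j ∧ k < l ∧ i ≠ k ∧ i ≠ l ∧ j ≠ k ∧ j ≠ l ∧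
      ¬ (crossBit x (v i) (w i j) (v k) (w k l) = 0 ∧ crossBit x (v i) (w i j) (w k l) (v l) = 0 ∧
        crossBit x (w i j) (v j) (v k) (w k l) = 0 ∧
        crossBit x (w i j) (v j) (w k l) (v l) = 0) := by
  by_contra! hcon
  have straight : ∀ i j k l, i < j → k < l → i ≠ k → i ≠ l → j ≠ k → j ≠ l →
      crossBit x (v i) (v j) (v k) (v l) =
        insideBit x (v i) (w i j) (v j) (v k) + insideBit x (v i) (w i j) (v j) (v l) +
        insideBit x (v k) (w k l) (v l) (v i) + insideBit x (v k) (w k l) (v l) (v j) := by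
    intro i j k l hij hkl hik hil hjk hjl
    obtain ⟨c₁, c₂, c₃, c₄⟩ := hcon i j k l hij hkl hik hil hjk hjl
    have hww := hw i j k l hij hkl hik
    -- `t₁` and `t₂` test the two halves of the path from `v k` to `v l` against the triangle on `v
    -- i`, `v j`; the bend `w k l` is counted twice and drops out. `t₃` then straightens that path
    -- against the segment from `v j` to `v i`.
    have t₁ := hx.crossBit_triangle (hvw i j i hij) (hv.ne hij.ne) (hvw i j j hij).symm
      (hvw k l k hkl) (hv.ne hik) (hvw i j k hij).symm (hv.ne hjk) (hvw k l i hkl) hww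
      (hvw k l j hkl)
    have t₂ := hx.crossBit_triangle (hvw i j i hij) (hv.ne hij.ne) (hvw i j j hij).symm
      (hvw k l l hkl).symm (hvw k l i hkl) hww (hvw k l j hkl) (hv.ne hil) (hvw i j l hij).symm
      (hv.ne hjl)
    have t₃ := hx.crossBit_triangle (hvw k l k hkl) (hv.ne hkl.ne) (hvw k l l hkl).symm
      (hv.ne hij.ne') (hv.ne hjk.symm) (hvw k l j hkl).symm (hv.ne hjl.symm) (hv.ne hik.symm)
      (hvw k l i hkl).symm (hv.ne hil.symm)
    rw [crossBit_comm x _ _ (v j) (v i), crossBit_comm x _ _ (v j) (v i),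
      crossBit_comm x _ _ (v j) (v i)] at t₃
    -- Reversing a segment flips both summands of one factor, which leaves their sum unchanged.
    have t₄ : crossBit x (v j) (v i) (v l) (v k) = crossBit x (v i) (v j) (v k) (v l) := by
      unfold crossBit
      rw [hx.swap (v i) (v j) (v l) (hv.ne hij.ne) (hv.ne hil) (hv.ne hjl),
        hx.swap (v i) (v j) (v k) (hv.ne hij.ne) (hv.ne hik) (hv.ne hjk),
        hx.swap (v k) (v l) (v j) (hv.ne hkl.ne) (hv.ne hjk.symm) (hv.ne hjl.symm),
        hx.swap (v k) (v l) (v i) (hv.ne hkl.ne) (hv.ne hik.symm) (hv.ne hil.symm)]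
      generalize x (v i) (v j) (v k) = p, x (v i) (v j) (v l) = q, x (v k) (v l) (v i) = r,
        x (v k) (v l) (v j) = s
      revert p q r s
      decide
    have two : (2 : ZMod 2) = 0 := rfl
    rw [t₄] at t₃
    linear_combination t₃ - t₁ - t₂ + c₁ + c₂ + c₃ + c₄ -
      (insideBit x (v i) (w i j) (v j) (v k) + insideBit x (v i) (w i j) (v j) (v l) +
        insideBit x (v i) (w i j) (v j) (w k l)) * two
  have h := hx.sum_crossBit_five hv
  rw [straight 0 1 2 3 (by decide) (by decide) (by decide) (by decide) (by decide)
      (by decide),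
    straight 0 2 1 3 (by decide) (by decide) (by decide) (by decide) (by decide)
      (by decide),
    straight 0 3 1 2 (by decide) (by decide) (by decide) (by decide) (by decide)
      (by decide),
    straight 0 1 2 4 (by decide) (by decide) (by decide) (by decide) (by decide)
      (by decide),
    straight 0 2 1 4 (by decide) (by decide) (by decide) (by decide) (by decide)
      (by decide),
    straight 0 4 1 2 (by decide) (by decide) (by decide) (by decide) (by decide)
      (by decide),
    straight 0 1 3 4 (by decide) (by decide) (by decide) (by decide) (by decide)
      (by decide),
    straight 0 3 1 4 (by decide) (by decide) (by decide) (by decide) (by decide)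
      (by decide),
    straight 0 4 1 3 (by decide) (by decide) (by decide) (by decide) (by decide)
      (by decide),
    straight 0 2 3 4 (by decide) (by decide) (by decide) (by decide) (by decide)
      (by decide),
    straight 0 3 2 4 (by decide) (by decide) (by decide) (by decide) (by decide)
      (by decide),
    straight 0 4 2 3 (by decide) (by decide) (by decide) (by decide) (by decide)
      (by decide),
    straight 1 2 3 4 (by decide) (by decide) (by decide) (by decide) (by decide)
      (by decide),
    straight 1 3 2 4 (by decide) (by decide) (by decide) (by decide) (by decide)
      (by decide),
    straight 1 4 2 3 (by decide) (by decide) (by decide) (by decide) (by decide)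
      (by decide)] at h
  -- For each edge `i j` and each other vertex `m`, the bit for `v m` in the triangle of `i j` now
  -- occurs twice, once for each edge at `m` independent of `i j`.
  have two : (2 : ZMod 2) = 0 := rfl
  ring_nf at h
  simp only [two, mul_zero, add_zero] at h
  exact zero_ne_one h

/-! ### Perturbation into general position, and crossing segments -/

open Filter Topology in
/-- A finite family of points in the plane can be moved into general position while keeping
disjoint any two segments between them that are disjoint. -/
theorem exists_generalPosition {V : Type*} [Finite V] (p : V → ℝ × ℝ) :
    ∃ q : V → ℝ × ℝ,
      (∀ a b c, a ≠ b → a ≠ c → b ≠ c → signedArea (q a) (q b) (q c) ≠ 0) ∧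
      ∀ a b c d, Disjoint (segment ℝ (p a) (p b)) (segment ℝ (p c) (p d)) →
        Disjoint (segment ℝ (q a) (q b)) (segment ℝ (q c) (q d)) := by
  obtain ⟨n, hn⟩ : ∃ n : V → ℝ, Function.Injective n := by
    obtain ⟨m, ⟨f⟩⟩ := Finite.exists_equiv_fin V
    exact ⟨fun v => ((f v : ℕ) : ℝ),
      Nat.cast_injective.comp (Fin.val_injective.comp f.injective)⟩
  -- The points move towards distinct points of a parabola, no three of which are collinear. The
  -- signed area of a triple is then quadratic in `t` with the Vandermonde product `C` as leading
  -- coefficient, so it vanishes for finitely many `t` only. The parameter `t = 0` is excluded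
  -- because `p` itself may be degenerate.
  let q : ℝ → V → ℝ × ℝ := fun t v => ((p v).1 + t * n v, (p v).2 + t * n v ^ 2)
  have hgen : ∀ a b c, ∀ᶠ t in 𝓝[≠] (0 : ℝ), a ≠ b → a ≠ c → b ≠ c →
      signedArea (q t a) (q t b) (q t c) ≠ 0 := by
    intro a b c
    by_cases habc : a ≠ b ∧ a ≠ c ∧ b ≠ c
    swap
    · exact Eventually.of_forall fun t h₁ h₂ h₃ => (habc ⟨h₁, h₂, h₃⟩).elim
    obtain ⟨hab, hac, hbc⟩ := habc
    let B : ℝ := ((p b).1 - (p a).1) * (n c ^ 2 - n a ^ 2) + (n b - n a) * ((p c).2 - (p a).2) -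
      ((p b).2 - (p a).2) * (n c - n a) - (n b ^ 2 - n a ^ 2) * ((p c).1 - (p a).1)
    let C : ℝ := (n b - n a) * (n c - n a) * (n c - n b)
    have hC : C ≠ 0 := mul_ne_zero (mul_ne_zero (sub_ne_zero.2 (hn.ne hab.symm))
      (sub_ne_zero.2 (hn.ne hac.symm))) (sub_ne_zero.2 (hn.ne hbc.symm))
    let P : Polynomial ℝ := .C C * .X ^ 2 + .C B * .X + .C (signedArea (p a) (p b) (p c))
    have hP : P ≠ 0 := fun h => by
      have := congrArg (Polynomial.coeff · 2) h
      simp [P] at this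
      exact hC this
    have hev := nhdsNE_le_cofinite (0 : ℝ)
      (P.roots.toFinset.finite_toSet.compl_mem_cofinite)
    filter_upwards [hev] with t ht _ _ _ h0
    refine ht ?_
    simp only [Finset.mem_coe, Multiset.mem_toFinset, Polynomial.mem_roots hP,
      Polynomial.IsRoot.def]
    rw [← h0]
    simp only [P, B, C, q, signedArea, Polynomial.eval_add, Polynomial.eval_mul,
      Polynomial.eval_C, Polynomial.eval_pow, Polynomial.eval_X]
    ring
  have hdisj : ∀ a b c d, ∀ᶠ t in 𝓝[≠] (0 : ℝ),
      Disjoint (segment ℝ (p a) (p b)) (segment ℝ (p c) (p d)) →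
        Disjoint (segment ℝ (q t a) (q t b)) (segment ℝ (q t c) (q t d)) := by
    intro a b c d
    by_cases h : Disjoint (segment ℝ (p a) (p b)) (segment ℝ (p c) (p d))
    swap
    · exact Eventually.of_forall fun t ht => (h ht).elim
    -- `F` is the difference of a point of each segment. It has no zero at `t = 0`, and compactness
    -- of the parameter square extends this to all `t` near `0`.
    let F : ℝ × ℝ × ℝ → ℝ × ℝ := fun z =>
      ((1 - z.2.1) • q z.1 a + z.2.1 • q z.1 b) - ((1 - z.2.2) • q z.1 c + z.2.2 • q z.1 d)
    have hF : Continuous F := by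
      simp only [F, q]
      fun_prop
    have hK : IsCompact (Set.Icc (0 : ℝ) 1 ×ˢ Set.Icc (0 : ℝ) 1) :=
      isCompact_Icc.prod isCompact_Icc
    have hev : ∀ᶠ t in 𝓝 (0 : ℝ), ∀ y ∈ Set.Icc (0 : ℝ) 1 ×ˢ Set.Icc (0 : ℝ) 1,
        F (t, y) ≠ 0 := by
      refine hK.eventually_forall_of_forall_eventually (P := fun t y => F (t, y) ≠ 0)
        fun y hy => ?_
      refine hF.continuousAt.eventually_ne ?_
      intro h0
      rw [segment_eq_image, segment_eq_image, Set.disjoint_left] at h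
      refine h ⟨y.1, hy.1, rfl⟩ ⟨y.2, hy.2, ?_⟩
      simpa [F, q] using (sub_eq_zero.1 h0).symm
    filter_upwards [hev.filter_mono nhdsWithin_le_nhds] with t ht _
    rw [segment_eq_image, segment_eq_image, Set.disjoint_left]
    rintro _ ⟨s, hs, rfl⟩ ⟨r, hr, hrs⟩
    exact ht (s, r) ⟨hs, hr⟩ (sub_eq_zero.2 hrs.symm)
  have hgen' := eventually_all.2 fun a => eventually_all.2 fun b => eventually_all.2 (hgen a b)
  have hdisj' := eventually_all.2 fun a => eventually_all.2 fun b =>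
    eventually_all.2 fun c => eventually_all.2 (hdisj a b c)
  obtain ⟨t, ht⟩ := (hgen'.and hdisj').exists
  exact ⟨q t, ht⟩

/-- If the endpoints of each of two segments lie on different sides of the other segment, then the
segments meet. -/
theorem not_disjoint_segment {a b c d : ℝ × ℝ}
    (h₁ : signedArea a b c * signedArea a b d < 0) (h₂ : signedArea c d a * signedArea c d b < 0) :
    ¬ Disjoint (segment ℝ a b) (segment ℝ c d) := by
  have ratio : ∀ {u v : ℝ}, u * v < 0 → u / (u - v) ∈ Set.Icc (0 : ℝ) 1 := by
    intro u v huv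
    rcases mul_neg_iff.1 huv with ⟨hu, hv⟩ | ⟨hu, hv⟩
    · exact ⟨div_nonneg hu.le (by linarith), (div_le_one (by linarith)).2 (by linarith)⟩
    · exact ⟨div_nonneg_of_nonpos hu.le (by linarith),
        (div_le_one_of_neg (by linarith)).2 (by linarith)⟩
  -- The lines are not parallel: otherwise `c` and `d` would have the same signed distance from the
  -- line `a b`.
  have hD : (b.1 - a.1) * (d.2 - c.2) - (b.2 - a.2) * (d.1 - c.1) ≠ 0 := by
    intro h0
    have : signedArea a b c = signedArea a b d := by
      unfold signedArea
      linear_combination -h0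
    rw [this] at h₁
    exact (mul_self_nonneg _).not_gt h₁
  have e₁ : signedArea a b c - signedArea a b d =
      -((b.1 - a.1) * (d.2 - c.2) - (b.2 - a.2) * (d.1 - c.1)) := by
    unfold signedArea
    ring
  have e₂ : signedArea c d a - signedArea c d b =
      (b.1 - a.1) * (d.2 - c.2) - (b.2 - a.2) * (d.1 - c.1) := by
    unfold signedArea
    ring
  rw [segment_eq_image, segment_eq_image, Set.not_disjoint_iff]
  -- By linear interpolation, the signed area relative to one line vanishes on the other segment at
  -- parameter `u / (u - v)`, where `u` and `v` are its values at the endpoints.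
  refine ⟨_, ⟨_, ratio h₂, rfl⟩, _, ratio h₁, ?_⟩
  rw [e₁, e₂]
  ext
  · simp only [Prod.fst_add, Prod.smul_fst, smul_eq_mul]
    field_simp
    unfold signedArea
    ring
  · simp only [Prod.snd_add, Prod.smul_snd, smul_eq_mul]
    field_simp
    unfold signedArea
    ring

theorem crossBit_eq_zero_of_disjoint {V : Type*} {p : V → ℝ × ℝ}
    (hp : ∀ a b c, a ≠ b → a ≠ c → b ≠ c → signedArea (p a) (p b) (p c) ≠ 0) {a b c d : V}
    (hab : a ≠ b) (hac : a ≠ c) (had : a ≠ d) (hbc : b ≠ c) (hbd : b ≠ d) (hcd : c ≠ d)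
    (h : Disjoint (segment ℝ (p a) (p b)) (segment ℝ (p c) (p d))) :
    crossBit (fun a b c => orientBit (p a) (p b) (p c)) a b c d = 0 := by
  rcases signBit_add (hp a b c hab hac hbc) (hp a b d hab had hbd) with ⟨-, h₁⟩ | ⟨h₁, -⟩
  · exact mul_eq_zero_of_left h₁ _
  rcases signBit_add (hp c d a hcd hac.symm had.symm) (hp c d b hcd hbc.symm hbd.symm) with ⟨-, h₂⟩ | ⟨h₂, -⟩
  · exact mul_eq_zero_of_right _ h₂
  exact (not_disjoint_segment h₁ h₂ h).elim

/-! ### Nonexistence of a one-layer drawing -/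

/-- The once subdivided complete graph on at least five vertices has no plane straight-line
drawing. -/
theorem not_isLayeredDrawing_one {k : ℕ} (hk : 5 ≤ k)
    (pos : Fin k ⊕ (⊤ : SimpleGraph (Fin k)).edgeSet → ℝ × ℝ)
    (layer : Sym2 (Fin k ⊕ (⊤ : SimpleGraph (Fin k)).edgeSet) → ℕ) :
    ¬ IsLayeredDrawing (subdividedComplete k) 1 pos layer := by
  intro hd
  obtain ⟨q, hq, hqd⟩ := exists_generalPosition pos
  let ι : Fin 5 → Fin k := Fin.castLE hk
  have hι : Function.Injective ι := Fin.castLE_injective hk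
  let w : Fin 5 → Fin 5 → Fin k ⊕ (⊤ : SimpleGraph (Fin k)).edgeSet := fun i j =>
    if h : ι i ≠ ι j then Sum.inr ⟨s(ι i, ι j), h⟩ else Sum.inl (ι i)
  have hw : ∀ i j (h : i < j), w i j = Sum.inr ⟨s(ι i, ι j), hι.ne h.ne⟩ := fun i j h =>
    dif_pos (hι.ne h.ne)
  have adj₁ : ∀ i j, i < j → (subdividedComplete k).Adj (Sum.inl (ι i)) (w i j) := by
    intro i j h
    rw [hw i j h]
    exact Sym2.mem_mk_left _ _
  have adj₂ : ∀ i j, i < j → (subdividedComplete k).Adj (w i j) (Sum.inl (ι j)) := by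
    intro i j h
    rw [hw i j h]
    exact Sym2.mem_mk_right _ _
  have hvw : ∀ i j m, i < j → (Sum.inl (ι m) : Fin k ⊕ _) ≠ w i j := by
    intro i j m h
    rw [hw i j h]
    exact Sum.inl_ne_inr
  have hv : Function.Injective fun i => (Sum.inl (ι i) : Fin k ⊕ (⊤ : SimpleGraph (Fin k)).edgeSet) :=
    Sum.inl_injective.comp hι
  have hww : ∀ i j m n, i < j → m < n → i ≠ m → w i j ≠ w m n := by
    intro i j m n hij hmn him h
    rw [hw i j hij, hw m n hmn, Sum.inr.injEq] at h
    have h' : s(ι i, ι j) = s(ι m, ι n) := congrArg Subtype.val h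
    rcases Sym2.eq_iff.1 h' with ⟨h, -⟩ | ⟨h₁, h₂⟩
    · exact him (hι h)
    · rw [hι h₁, hι h₂] at hij
      exact hij.not_gt hmn
  have cross : ∀ a b c d, (subdividedComplete k).Adj a b → (subdividedComplete k).Adj c d →
      a ≠ c → a ≠ d → b ≠ c → b ≠ d →
      crossBit (fun a b c => orientBit (q a) (q b) (q c)) a b c d = 0 := by
    intro a b c d hab hcd hac had hbc hbd
    refine crossBit_eq_zero_of_disjoint hq hab.ne hac had hbc hbd hcd.ne (hqd _ _ _ _ ?_)
    have l₁ := hd.layer_lt s(a, b) hab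
    have l₂ := hd.layer_lt s(c, d) hcd
    have hsub := hd.noncrossing a b c d hab hcd (by simp [hac, had]) (by omega)
    have hempty : ({a, b} : Set (Fin k ⊕ (⊤ : SimpleGraph (Fin k)).edgeSet)) ∩ {c, d} = ∅ := by
      ext z
      simp only [Set.mem_inter_iff, Set.mem_insert_iff, Set.mem_singleton_iff,
        Set.mem_empty_iff_false, iff_false]
      rintro ⟨rfl | rfl, rfl | rfl⟩ <;> contradiction
    rw [hempty, Set.image_empty] at hsub
    exact Set.disjoint_iff.2 hsub
  obtain ⟨i, j, m, n, hij, hmn, him, hin, hjm, hjn, hne⟩ :=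
    (isOrientation_orientBit hq).exists_crossBit_ne_zero hv hvw hww
  have hw' := hww i j m n hij hmn him
  exact hne ⟨
    cross _ _ _ _ (adj₁ i j hij) (adj₁ m n hmn) (hv.ne him) (hvw m n i hmn)
      (hvw i j m hij).symm hw',
    cross _ _ _ _ (adj₁ i j hij) (adj₂ m n hmn) (hvw m n i hmn) (hv.ne hin) hw'
      (hvw i j n hij).symm,
    cross _ _ _ _ (adj₂ i j hij) (adj₁ m n hmn) (hvw i j m hij).symm hw' (hv.ne hjm)
      (hvw m n j hmn),
    cross _ _ _ _ (adj₂ i j hij) (adj₂ m n hmn) hw' (hvw i j n hij).symm (hvw m n j hmn)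
      (hv.ne hjn)⟩

/-! ### The two-layer staircase drawing -/

theorem exists_lt_of_mem_edgeSet_top {α : Type*} [LinearOrder α]
    (e : (⊤ : SimpleGraph α).edgeSet) : ∃ i j, i < j ∧ (e : Sym2 α) = s(i, j) := by
  obtain ⟨e, he⟩ := e
  induction e using Sym2.ind with
  | _ a b =>
    rcases lt_or_gt_of_ne (show a ≠ b from he) with h | h
    · exact ⟨a, b, h, rfl⟩
    · exact ⟨b, a, h, Sym2.eq_swap⟩

section StaircaseDrawing

variable {k : ℕ}

/-- The drawing with `v_i` at `(i, i + 1)` and the subdivision vertex of `v_i v_j`, for `i < j`, at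
`(j + 1, i)`. -/
def staircasePos : Fin k ⊕ (⊤ : SimpleGraph (Fin k)).edgeSet → ℝ × ℝ
  | Sum.inl i => ((i : ℝ), (i : ℝ) + 1)
  | Sum.inr e => (((e : Sym2 (Fin k)).sup : ℝ) + 1, ((e : Sym2 (Fin k)).inf : ℝ))

open Classical in
/-- The layer `0` consists of the edges joining a subdivision vertex to its smaller neighbour. -/
noncomputable def staircaseLayer (z : Sym2 (Fin k ⊕ (⊤ : SimpleGraph (Fin k)).edgeSet)) : ℕ :=
  if ∃ e : (⊤ : SimpleGraph (Fin k)).edgeSet,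
    z = s(Sum.inl (e : Sym2 (Fin k)).inf, Sum.inr e) then 0 else 1

theorem staircasePos_inl (i : Fin k) : staircasePos (Sum.inl i) = ((i : ℝ), (i : ℝ) + 1) := rfl

theorem staircasePos_inr {e : (⊤ : SimpleGraph (Fin k)).edgeSet} {i j : Fin k} (hij : i < j)
    (he : (e : Sym2 (Fin k)) = s(i, j)) : staircasePos (Sum.inr e) = ((j : ℝ) + 1, (i : ℝ)) := by
  simp [staircasePos, he, hij.le]

theorem staircaseLayer_inf {e : (⊤ : SimpleGraph (Fin k)).edgeSet} {i j : Fin k} (hij : i < j)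
    (he : (e : Sym2 (Fin k)) = s(i, j)) : staircaseLayer s(Sum.inl i, Sum.inr e) = 0 :=
  if_pos ⟨e, by simp [he, hij.le]⟩

theorem staircaseLayer_sup {e : (⊤ : SimpleGraph (Fin k)).edgeSet} {i j : Fin k} (hij : i < j)
    (he : (e : Sym2 (Fin k)) = s(i, j)) : staircaseLayer s(Sum.inl j, Sum.inr e) = 1 := by
  refine if_neg ?_
  rintro ⟨f, hf⟩
  rw [Sym2.eq_iff] at hf
  rcases hf with ⟨h₁, h₂⟩ | ⟨h₁, -⟩
  · rw [← Sum.inr_injective h₂, he, Sym2.inf_mk, inf_eq_left.2 hij.le] at h₁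
    exact hij.ne' (Sum.inl_injective h₁)
  · exact Sum.inl_ne_inr h₁

theorem injective_staircasePos : Function.Injective (staircasePos (k := k)) := by
  rintro (i | e) (i' | e') h
  · rw [staircasePos_inl, staircasePos_inl, Prod.mk.injEq, Nat.cast_inj] at h
    rw [Fin.ext h.1]
  · obtain ⟨a, b, hab, he⟩ := exists_lt_of_mem_edgeSet_top e'
    rw [staircasePos_inl, staircasePos_inr hab he, Prod.mk.injEq] at h
    norm_cast at h
    omega
  · obtain ⟨a, b, hab, he⟩ := exists_lt_of_mem_edgeSet_top e
    rw [staircasePos_inl, staircasePos_inr hab he, Prod.mk.injEq] at h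
    norm_cast at h
    omega
  · obtain ⟨a, b, hab, he⟩ := exists_lt_of_mem_edgeSet_top e
    obtain ⟨a', b', hab', he'⟩ := exists_lt_of_mem_edgeSet_top e'
    rw [staircasePos_inr hab he, staircasePos_inr hab' he', Prod.mk.injEq] at h
    norm_cast at h
    obtain rfl : b = b' := by omega
    obtain rfl : a = a' := by omega
    rw [Subtype.ext (he.trans he'.symm)]

theorem mem_segment_staircase_inf {e : (⊤ : SimpleGraph (Fin k)).edgeSet} {i j : Fin k}
    (hij : i < j) (he : (e : Sym2 (Fin k)) = s(i, j)) {P : ℝ × ℝ}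
    (hP : P ∈ segment ℝ (staircasePos (Sum.inl i)) (staircasePos (Sum.inr e))) :
    ∃ t : ℝ, 0 ≤ t ∧ t ≤ 1 ∧ P.1 = i + t * (j + 1 - i) ∧ P.2 = i + 1 - t := by
  rw [staircasePos_inl, staircasePos_inr hij he, segment_eq_image'] at hP
  obtain ⟨t, ht, rfl⟩ := hP
  exact ⟨t, ht.1, ht.2, by simp, by simp; ring⟩

theorem mem_segment_staircase_sup {e : (⊤ : SimpleGraph (Fin k)).edgeSet} {i j : Fin k}
    (hij : i < j) (he : (e : Sym2 (Fin k)) = s(i, j)) {P : ℝ × ℝ}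
    (hP : P ∈ segment ℝ (staircasePos (Sum.inl j)) (staircasePos (Sum.inr e))) :
    ∃ t : ℝ, 0 ≤ t ∧ t ≤ 1 ∧ P.1 = j + t ∧ P.2 = j + 1 - t * (j + 1 - i) := by
  rw [staircasePos_inl, staircasePos_inr hij he, segment_eq_image'] at hP
  obtain ⟨t, ht, rfl⟩ := hP
  exact ⟨t, ht.1, ht.2, by simp, by simp; ring⟩

/-- Integers at distance a number in `[0, 1]` are equal or consecutive. -/
theorem eq_zero_or_eq_one_of_natCast_add {m n : ℕ} {t : ℝ} (h₀ : 0 ≤ t) (h₁ : t ≤ 1)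
    (h : (n : ℝ) = m + t) : (t = 0 ∧ n = m) ∨ (t = 1 ∧ n = m + 1) := by
  have h₂ : m ≤ n := by
    have : (m : ℝ) ≤ n := by linarith
    exact_mod_cast this
  have h₃ : n ≤ m + 1 := by
    have : (n : ℝ) ≤ m + 1 := by linarith
    exact_mod_cast this
  rcases (by omega : n = m ∨ n = m + 1) with rfl | rfl
  · exact Or.inl ⟨by linarith, rfl⟩
  · push_cast at h
    exact Or.inr ⟨by linarith, rfl⟩

/-- The segment descends by exactly one, between integer heights, and every vertex has integer
height; so a vertex on it is at an end. -/
theorem staircase_vertex_inf {e : (⊤ : SimpleGraph (Fin k)).edgeSet} {i j : Fin k}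
    (hij : i < j) (he : (e : Sym2 (Fin k)) = s(i, j))
    (z : Fin k ⊕ (⊤ : SimpleGraph (Fin k)).edgeSet)
    (hz : staircasePos z ∈ segment ℝ (staircasePos (Sum.inl i)) (staircasePos (Sum.inr e))) :
    z = Sum.inl i ∨ z = Sum.inr e := by
  obtain ⟨t, h₀, h₁, hx, hy⟩ := mem_segment_staircase_inf hij he hz
  have key : t = 0 ∨ t = 1 := by
    have : ∃ n : ℕ, (staircasePos z).2 = n := by
      rcases z with m | f
      · exact ⟨m + 1, by simp [staircasePos]⟩
      · exact ⟨_, rfl⟩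
    obtain ⟨n, hn⟩ := this
    have h : ((i + 1 : ℕ) : ℝ) = n + t := by push_cast; linarith
    rcases eq_zero_or_eq_one_of_natCast_add h₀ h₁ h with h | h
    · exact Or.inl h.1
    · exact Or.inr h.1
  rcases key with rfl | rfl
  · refine Or.inl (injective_staircasePos (Prod.ext ?_ ?_))
    · simp [hx, staircasePos_inl]
    · simp [hy, staircasePos_inl]
  · refine Or.inr (injective_staircasePos (Prod.ext ?_ ?_))
    · simp [hx, staircasePos_inr hij he]
    · simp [hy, staircasePos_inr hij he]

/-- The same argument with the horizontal coordinate, which increases by one along the segment. -/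
theorem staircase_vertex_sup {e : (⊤ : SimpleGraph (Fin k)).edgeSet} {i j : Fin k}
    (hij : i < j) (he : (e : Sym2 (Fin k)) = s(i, j))
    (z : Fin k ⊕ (⊤ : SimpleGraph (Fin k)).edgeSet)
    (hz : staircasePos z ∈ segment ℝ (staircasePos (Sum.inl j)) (staircasePos (Sum.inr e))) :
    z = Sum.inl j ∨ z = Sum.inr e := by
  obtain ⟨t, h₀, h₁, hx, hy⟩ := mem_segment_staircase_sup hij he hz
  have key : t = 0 ∨ t = 1 := by
    have : ∃ n : ℕ, (staircasePos z).1 = n := by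
      rcases z with m | f
      · exact ⟨m, rfl⟩
      · exact ⟨(f : Sym2 (Fin k)).sup + 1, by simp [staircasePos]⟩
    obtain ⟨n, hn⟩ := this
    rcases eq_zero_or_eq_one_of_natCast_add h₀ h₁ (hn.symm.trans hx) with h | h
    · exact Or.inl h.1
    · exact Or.inr h.1
  rcases key with rfl | rfl
  · refine Or.inl (injective_staircasePos (Prod.ext ?_ ?_))
    · simp [hx, staircasePos_inl]
    · simp [hy, staircasePos_inl]
  · refine Or.inr (injective_staircasePos (Prod.ext ?_ ?_))
    · simp [hx, staircasePos_inr hij he]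
    · simp [hy, staircasePos_inr hij he]

/-- The first-layer edges at `v_i` lie in the strip $i \le y \le i+1$ and fan out from `v_i` with
different slopes. For $i < i'$ the strips meet at most in a line, reached by the lower edge at `v_i`
and by the upper one at its subdivision vertex, which is strictly to the right of `v_i`. -/
theorem staircase_crossing_inf {e e' : (⊤ : SimpleGraph (Fin k)).edgeSet} {i j i' j' : Fin k}
    (hij : i < j) (he : (e : Sym2 (Fin k)) = s(i, j)) (hij' : i' < j')
    (he' : (e' : Sym2 (Fin k)) = s(i', j')) (hne : e ≠ e') {P : ℝ × ℝ}
    (hP : P ∈ segment ℝ (staircasePos (Sum.inl i)) (staircasePos (Sum.inr e)))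
    (hP' : P ∈ segment ℝ (staircasePos (Sum.inl i')) (staircasePos (Sum.inr e'))) :
    i = i' ∧ P = staircasePos (Sum.inl i) := by
  wlog hii : i ≤ i' generalizing e e' i j i' j'
  · obtain ⟨h, hP⟩ := this hij' he' hij he hne.symm hP' hP (le_of_not_ge hii)
    exact ⟨h.symm, h ▸ hP⟩
  obtain ⟨t, h₀, h₁, hx, hy⟩ := mem_segment_staircase_inf hij he hP
  obtain ⟨t', h₀', h₁', hx', hy'⟩ := mem_segment_staircase_inf hij' he' hP'
  rcases hii.eq_or_lt with rfl | hii
  · have htt : t = t' := by linarith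
    subst htt
    have hjj : (j : ℝ) - j' ≠ 0 := by
      rw [sub_ne_zero, Ne, Nat.cast_inj, ← Fin.ext_iff]
      rintro rfl
      exact hne (Subtype.ext (he.trans he'.symm))
    obtain rfl : t = 0 := by
      refine (mul_eq_zero.1 (?_ : t * ((j : ℝ) - j') = 0)).resolve_right hjj
      linarith
    refine ⟨rfl, Prod.ext ?_ ?_⟩
    · simp [hx, staircasePos_inl]
    · simp [hy, staircasePos_inl]
  · exfalso
    have h : ((i : ℕ) : ℝ) + 1 ≤ i' := by exact_mod_cast hii
    have hj : ((i' : ℕ) : ℝ) + 1 ≤ j' := by exact_mod_cast hij'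
    obtain rfl : t = 0 := by linarith
    obtain rfl : t' = 1 := by linarith
    linarith

/-- The strips are now $j \le x \le j+1$. On a line common to two of them, the left edge ends at its
subdivision vertex, strictly below the vertex `v_{j'}` where the right edge starts. -/
theorem staircase_crossing_sup {e e' : (⊤ : SimpleGraph (Fin k)).edgeSet} {i j i' j' : Fin k}
    (hij : i < j) (he : (e : Sym2 (Fin k)) = s(i, j)) (hij' : i' < j')
    (he' : (e' : Sym2 (Fin k)) = s(i', j')) (hne : e ≠ e') {P : ℝ × ℝ}
    (hP : P ∈ segment ℝ (staircasePos (Sum.inl j)) (staircasePos (Sum.inr e)))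
    (hP' : P ∈ segment ℝ (staircasePos (Sum.inl j')) (staircasePos (Sum.inr e'))) :
    j = j' ∧ P = staircasePos (Sum.inl j) := by
  wlog hjj : j ≤ j' generalizing e e' i j i' j'
  · obtain ⟨h, hP⟩ := this hij' he' hij he hne.symm hP' hP (le_of_not_ge hjj)
    exact ⟨h.symm, h ▸ hP⟩
  obtain ⟨t, h₀, h₁, hx, hy⟩ := mem_segment_staircase_sup hij he hP
  obtain ⟨t', h₀', h₁', hx', hy'⟩ := mem_segment_staircase_sup hij' he' hP'
  rcases hjj.eq_or_lt with rfl | hjj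
  · have htt : t = t' := by linarith
    subst htt
    have hii : (i : ℝ) - i' ≠ 0 := by
      rw [sub_ne_zero, Ne, Nat.cast_inj, ← Fin.ext_iff]
      rintro rfl
      exact hne (Subtype.ext (he.trans he'.symm))
    obtain rfl : t = 0 := by
      refine (mul_eq_zero.1 (?_ : t * ((i : ℝ) - i') = 0)).resolve_right hii
      linarith
    refine ⟨rfl, Prod.ext ?_ ?_⟩
    · simp [hx, staircasePos_inl]
    · simp [hy, staircasePos_inl]
  · exfalso
    have h : ((j : ℕ) : ℝ) + 1 ≤ j' := by exact_mod_cast hjj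
    have hi : ((i : ℕ) : ℝ) + 1 ≤ j := by exact_mod_cast hij
    obtain rfl : t' = 0 := by linarith
    obtain rfl : t = 1 := by linarith
    linarith

/-- Every edge of the subdivided complete graph joins a subdivision vertex to its smaller or to
its larger neighbour. -/
theorem subdividedComplete_adj_cases
    {motive : (u v : Fin k ⊕ (⊤ : SimpleGraph (Fin k)).edgeSet) → Prop}
    (symm : ∀ u v, motive u v → motive v u)
    (inf : ∀ (e : (⊤ : SimpleGraph (Fin k)).edgeSet) (i j : Fin k), i < j →
      (e : Sym2 (Fin k)) = s(i, j) → motive (Sum.inl i) (Sum.inr e))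
    (sup : ∀ (e : (⊤ : SimpleGraph (Fin k)).edgeSet) (i j : Fin k), i < j →
      (e : Sym2 (Fin k)) = s(i, j) → motive (Sum.inl j) (Sum.inr e))
    {u v : Fin k ⊕ (⊤ : SimpleGraph (Fin k)).edgeSet} (h : (subdividedComplete k).Adj u v) :
    motive u v := by
  have key : ∀ (m : Fin k) (e : (⊤ : SimpleGraph (Fin k)).edgeSet), m ∈ (e : Sym2 (Fin k)) →
      motive (Sum.inl m) (Sum.inr e) := by
    intro m e hm
    obtain ⟨i, j, hij, he⟩ := exists_lt_of_mem_edgeSet_top e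
    rw [he, Sym2.mem_iff] at hm
    rcases hm with rfl | rfl
    · exact inf e _ _ hij he
    · exact sup e _ _ hij he
  rcases u with u | e <;> rcases v with v | f
  · exact h.elim
  · exact key u f h
  · exact symm _ _ (key v e h)
  · exact h.elim

theorem isLayeredDrawing_staircase :
    IsLayeredDrawing (subdividedComplete k) 2 staircasePos staircaseLayer where
  injective := injective_staircasePos
  vertex_notMem u v w huv hu hv hw := by
    revert hu hv hw
    refine subdividedComplete_adj_cases
      (motive := fun u v => w ≠ u → w ≠ v →
        staircasePos w ∈ segment ℝ (staircasePos u) (staircasePos v) → False)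
      (fun u v h hu hv hw => h hv hu (by rwa [segment_symm])) ?_ ?_ huv
    · intro e i j hij he hu hv hw
      exact (staircase_vertex_inf hij he w hw).elim hu hv
    · intro e i j hij he hu hv hw
      exact (staircase_vertex_sup hij he w hw).elim hu hv
  layer_lt z _ := by
    unfold staircaseLayer
    split_ifs <;> decide
  noncrossing u v w x huv hwx := by
    have share : ∀ (m : Fin k) (e f : (⊤ : SimpleGraph (Fin k)).edgeSet),
        staircasePos (Sum.inl m) ∈
          staircasePos '' (({Sum.inl m, Sum.inr e} : Set _) ∩ {Sum.inl m, Sum.inr f}) :=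
      fun m e f => ⟨_, ⟨Or.inl rfl, Or.inl rfl⟩, rfl⟩
    refine subdividedComplete_adj_cases
      (motive := fun u v => s(u, v) ≠ s(w, x) → staircaseLayer s(u, v) = staircaseLayer s(w, x) →
        segment ℝ (staircasePos u) (staircasePos v) ∩ segment ℝ (staircasePos w) (staircasePos x) ⊆
          staircasePos '' ({u, v} ∩ {w, x}))
      (fun u v h hu hv => by
        rw [segment_symm, Set.pair_comm]
        exact h (by rwa [Sym2.eq_swap]) (by rwa [Sym2.eq_swap])) ?_ ?_ huv
    all_goals
      intro e i j hij he
      refine subdividedComplete_adj_cases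
        (motive := fun w x => s(_, _) ≠ s(w, x) →
          staircaseLayer s(_, _) = staircaseLayer s(w, x) →
          segment ℝ _ _ ∩ segment ℝ (staircasePos w) (staircasePos x) ⊆
            staircasePos '' (_ ∩ {w, x}))
        (fun w x h hu hv => by
          rw [segment_symm ℝ (staircasePos x), Set.pair_comm x w]
          exact h (by rwa [Sym2.eq_swap (a := w)]) (by rwa [Sym2.eq_swap (a := w)])) ?_ ?_ hwx
      all_goals intro f i' j' hij' hf hne hlayer P hP
    · have hef : e ≠ f := by
        rintro rfl
        refine hne ?_
        have := he.symm.trans hf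
        have h₁ := congrArg Sym2.inf this
        simp only [Sym2.inf_mk, inf_eq_left.2 hij.le, inf_eq_left.2 hij'.le] at h₁
        rw [h₁]
      obtain ⟨rfl, rfl⟩ := staircase_crossing_inf hij he hij' hf hef hP.1 hP.2
      exact share _ _ _
    -- An edge at a smaller neighbour and one at a larger neighbour are on different layers.
    · rw [staircaseLayer_inf hij he, staircaseLayer_sup hij' hf] at hlayer
      exact (zero_ne_one hlayer).elim
    · rw [staircaseLayer_sup hij he, staircaseLayer_inf hij' hf] at hlayer
      exact (one_ne_zero hlayer).elim
    · have hef : e ≠ f := by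
        rintro rfl
        refine hne ?_
        have := he.symm.trans hf
        have h₁ := congrArg Sym2.sup this
        simp only [Sym2.sup_mk, sup_eq_right.2 hij.le, sup_eq_right.2 hij'.le] at h₁
        rw [h₁]
      obtain ⟨rfl, rfl⟩ := staircase_crossing_sup hij he hij' hf hef hP.1 hP.2
      exact share _ _ _

end StaircaseDrawing

/-! ### Monotonicity in the number of layers, and the conclusion -/

theorem IsLayeredDrawing.mono {V : Type*} {G : SimpleGraph V} {m n : ℕ} {pos : V → ℝ × ℝ}
    {layer : Sym2 V → ℕ} (h : IsLayeredDrawing G m pos layer) (hmn : m ≤ n) :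
    IsLayeredDrawing G n pos layer where
  injective := h.injective
  vertex_notMem := h.vertex_notMem
  layer_lt e he := (h.layer_lt e he).trans_le hmn
  noncrossing := h.noncrossing

theorem theorem1 (k : ℕ) (hk : 5 ≤ k) :
    geometricThickness (subdividedComplete k) = 2 ∧
    ∃ (pos : Fin k ⊕ (⊤ : SimpleGraph (Fin k)).edgeSet → ℝ × ℝ)
      (layer : Sym2 (Fin k ⊕ (⊤ : SimpleGraph (Fin k)).edgeSet) → ℕ),
      IsLayeredDrawing (subdividedComplete k) 2 pos layer ∧
      (∀ i : Fin k, pos (Sum.inl i) = ((i : ℝ), (i : ℝ) + 1)) ∧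
      (∀ (i j : Fin k) (e : (⊤ : SimpleGraph (Fin k)).edgeSet), i < j → (e : Sym2 (Fin k)) = s(i, j) →
        pos (Sum.inr e) = ((j : ℝ) + 1, (i : ℝ)) ∧
        layer s(Sum.inl i, Sum.inr e) = 0 ∧
        layer s(Sum.inr e, Sum.inl j) = 1) := by
  refine ⟨le_antisymm ?_ ?_, staircasePos, staircaseLayer, isLayeredDrawing_staircase,
    staircasePos_inl, fun i j e hij he => ⟨staircasePos_inr hij he, staircaseLayer_inf hij he, ?_⟩⟩
  · exact iInf₂_le 2 ⟨staircasePos, staircaseLayer, isLayeredDrawing_staircase⟩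
  · refine le_iInf₂ fun n ⟨pos, layer, h⟩ => ?_
    by_contra! hn
    have hn' : n < 2 := by exact_mod_cast hn
    -- Monotonicity also covers `n = 0`.
    exact not_isLayeredDrawing_one hk pos layer (h.mono (by omega))
  · rw [Sym2.eq_swap]
    exact staircaseLayer_sup hij he
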